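/- Let $\mathcal X$ be a finite alphabet of cardinality $\alpha$; all logarithms are to base 2. Definitions. For $x^n=(x_1,\dots,x_n)\in\mathcal X^n$ let $c(x^n)$ be the number of phrases of the LZ78 incremental parsing of $x^n$ (each phrase is the shortest string that is not one of the earlier phrases; a possibly incomplete last phrase is counted), and let $\rho_{LZ}(x^n)=\frac{c(x^n)\log c(x^n)}{n}$. A finite-state encoder consists of a finite state set $\mathcal Z$, an output function $f$ from $\mathcal Z\times\mathcal X$ to finite (possibly empty) binary strings, a next-state function $g:\mathcal Z\times\mathcal X\to\mathcal Z$ and an initial state; it is information lossless if, for every starting state and every length, an input segment of that length is uniquely determined by the starting state, the concatenated binary output and the final state. Let $\rho_s(x^n)$ be the minimum, over all information lossless encoders with at most $s$ states, of the total output length (in bits) on $x^n$ divided by $n$. Let $\hat H_{csw}(X^m)$ be the entropy of the empirical distribution of the $n$ cyclic windows of length $m$ of $x^n$ (indices modulo $n$), and, when $m$ divides $n$, let $\hat H_{nob}(X^m)$ be the entropy of the empirical distribution of the $n/m$ consecutive non-overlapping blocks of length $m$ of $x^n$. Call $\epsilon_2:\mathbb N\times\mathbb N\to\mathbb R$ a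 redundancy term if $\epsilon_2(n,s)\to0$ as $n\to\infty$ for each fixed $s\ge1$, and $$\rho_s(x^n)\ge\rho_{LZ}(x^n)-\epsilon_2(n,s)\qquad\text{for all } s\ge1,\ n\ge1,\ x^n\in\mathcal X^n .$$ Theorem. Redundancy terms exist. Moreover, for every redundancy term $\epsilon_2$, every positive integer $k$, every positive integer $n$ that is a multiple of $k$, every $x^n\in\mathcal X^n$ and every positive integer $m\le n$, $$\frac kn\sum_{i=0}^{n/k-1}\rho_{LZ}(x_{ik+1}^{ik+k})\le\frac{\hat H_{csw}(X^m)}{m}+\frac1m+\frac{2(m+1)\alpha^{m+1}}{n}\log\frac nm+\epsilon_2(k,\alpha^{2m}),$$ and, if $m$ divides $n$, also $$\frac kn\sum_{i=0}^{n/k-1}\rho_{LZ}(x_{ik+1}^{ik+k})\le\frac{\hat H_{nob}(X^m)}{m}+\frac1m+\epsilon_2(k,\alpha^{2m}).$$ -/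

import Mathlib

open Filter Topology

namespace LZBlocks

universe u

/-! ### Finite-state encoders -/

/-- A finite-state encoder with input alphabet `X` and state set `Z`: output function `f` with
values in the binary strings (possibly empty), next-state function `g`, fixed initial state. When
`X` and `Z` are finite, the set of output strings is automatically finite. -/
structure FSEncoder (X : Type u) (Z : Type) where
  /-- the fixed initial state -/
  init : Z
  /-- the output function -/
  f : Z → X → List Bool
  /-- the next-state function -/
  g : Z → X → Z

namespace FSEncoder

variable {X : Type u} {Z : Type}

/-- The (concatenated) binary output produced on an input segment, started in state `z`. -/
def output (E : FSEncoder X Z) : Z → List X → List Bool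
  | _, [] => []
  | z, a :: l => E.f z a ++ E.output (E.g z a) l

/-- The state reached after processing an input segment, started in state `z`. -/
def finalState (E : FSEncoder X Z) : Z → List X → Z
  | z, [] => z
  | z, a :: l => E.finalState (E.g z a) l

/-- Information losslessness: for every initial state and every length `n`, an input segment of
length `n` is determined by the initial state, the binary output and the final state. -/
def InformationLossless (E : FSEncoder X Z) : Prop :=
  ∀ (z : Z) (n : ℕ) (v w : List X), v.length = n → w.length = n →
    E.output z v = E.output z w → E.finalState z v = E.finalState z w → v = w

/-- The compression ratio `L(uⁿ) / n` of the encoder on `xⁿ`, in bits per symbol. -/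
noncomputable def compressionRatio (E : FSEncoder X Z) {n : ℕ} (x : Fin n → X) : ℝ :=
  ((E.output E.init (List.ofFn x)).length : ℝ) / n

end FSEncoder

/-- The `s`-state compressibility `ρ_s(xⁿ)`: the least compression ratio on `xⁿ` of an information
lossless encoder with at most `s` states. (For `s ≥ 1` and finite `X` the set is nonempty, and all
its elements are nonnegative multiples of `1 / n`, so that the infimum is a minimum.) -/
noncomputable def compressibility {X : Type u} (s : ℕ) {n : ℕ} (x : Fin n → X) : ℝ :=
  sInf {r : ℝ | ∃ (Z : Type) (_ : Fintype Z) (E : FSEncoder X Z),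
    Fintype.card Z ≤ s ∧ E.InformationLossless ∧ r = E.compressionRatio x}

/-! ### Incremental (LZ78) parsing -/

section Parsing

variable {X : Type u} [DecidableEq X]

/-- Incremental parsing: `dict` is the list of the complete phrases so far, `cur` the part already
read of the current phrase. The current phrase ends as soon as it is not one of the earlier
phrases; a nonempty incomplete last phrase counts as a phrase. -/
def lzParseAux : List (List X) → List X → List X → List (List X)
  | _, cur, [] => if cur = [] then [] else [cur]
  | dict, cur, a :: l =>
      if cur ++ [a] ∈ dict then lzParseAux dict (cur ++ [a]) l
      else (cur ++ [a]) :: lzParseAux ((cur ++ [a]) :: dict) [] l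

/-- The phrases of the incremental parsing of a string. -/
def lzParse (l : List X) : List (List X) := lzParseAux [] [] l

/-- `c(xⁿ)`, the number of phrases of the incremental parsing of `xⁿ`. -/
def lzCount {n : ℕ} (x : Fin n → X) : ℕ := (lzParse (List.ofFn x)).length

/-- The normalized LZ complexity `c(xⁿ) log₂ c(xⁿ) / n`. -/
noncomputable def lzComplexity {n : ℕ} (x : Fin n → X) : ℝ :=
  (lzCount x : ℝ) * Real.logb 2 (lzCount x) / n

end Parsing

/-! ### Blocks, windows and empirical entropies -/

section Blocks

variable {X : Type u} {n : ℕ}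

/-- The `i`-th non-overlapping block of length `d` of `xⁿ`, `i = 0, …, ⌊n/d⌋ - 1`. -/
def block (x : Fin n → X) (d : ℕ) (i : Fin (n / d)) : Fin d → X := fun j =>
  x ⟨i * d + j, by
    have h1 : ((i : ℕ) + 1) * d ≤ n / d * d := Nat.mul_le_mul_right d i.isLt
    have h2 : n / d * d ≤ n := Nat.div_mul_le_self n d
    have h3 := j.isLt
    rw [Nat.add_mul, Nat.one_mul] at h1
    omega⟩

/-- The cyclic window of length `d` of `xⁿ` that starts at (zero-based) position `i`. -/
def cyclicWindow (x : Fin n → X) (d : ℕ) (i : Fin n) : Fin d → X := fun j =>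
  x ⟨(i + j) % n, Nat.mod_lt _ (Nat.lt_of_le_of_lt (Nat.zero_le _) i.isLt)⟩

/-- The relative frequency of `a` in a finite family `w`. -/
noncomputable def empiricalDist {ι A : Type*} [Fintype ι] [DecidableEq A] (w : ι → A) (a : A) : ℝ :=
  ((Finset.univ.filter fun i => w i = a).card : ℝ) / Fintype.card ι

/-- The entropy, in bits, of the empirical distribution of a finite family `w`. -/
noncomputable def empiricalEntropy {ι A : Type*} [Fintype ι] [Fintype A] [DecidableEq A]
    (w : ι → A) : ℝ :=
  -∑ a : A, empiricalDist w a * Real.logb 2 (empiricalDist w a)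

variable [Fintype X] [DecidableEq X]

/-- `Ĥ_csw(X^d)[xⁿ]`: the empirical entropy of the cyclic sliding windows of length `d`. -/
noncomputable def cswEntropy (x : Fin n → X) (d : ℕ) : ℝ :=
  empiricalEntropy (cyclicWindow x d)

/-- `Ĥ_nob(X^d)[xⁿ]`: the empirical entropy of the non-overlapping blocks of length `d`
(meaningful when `d` divides `n`). -/
noncomputable def nobEntropy (x : Fin n → X) (d : ℕ) : ℝ :=
  empiricalEntropy (block x d)

end Blocks

/-- The average `(k/n) ∑ᵢ ρ_LZ(x_{ik+1}^{ik+k})` of the normalized LZ complexities of the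
`k`-blocks of `xⁿ`. -/
noncomputable def avgBlockLZ {X : Type u} [DecidableEq X] {n : ℕ} (x : Fin n → X) (k : ℕ) : ℝ :=
  (k : ℝ) / n * ∑ i : Fin (n / k), lzComplexity (block x k i)

/-- `ε₂(n, s)` is a redundancy term over the alphabet `X`: it vanishes as `n → ∞` for each fixed
number `s` of states, and `ρ_s(xⁿ) ≥ ρ_LZ(xⁿ) - ε₂(n, s)` for all `xⁿ`, uniformly. -/
def IsRedundancyTerm (X : Type u) [DecidableEq X] (ε₂ : ℕ → ℕ → ℝ) : Prop :=
  (∀ s : ℕ, 1 ≤ s → Tendsto (fun n => ε₂ n s) atTop (𝓝 0)) ∧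
  ∀ s : ℕ, 1 ≤ s → ∀ n : ℕ, 1 ≤ n → ∀ x : Fin n → X,
    lzComplexity x - ε₂ n s ≤ compressibility s x

end LZBlocks

/-! A lossless encoder stays lossless when started in another state. So the run of one s-state
encoder on x^n can be cut along the k-blocks, and its output on each block has at least k(ρ_LZ −
ε₂(k, s)) bits. Hence the average block complexity is at most the rate of the run plus ε₂(k, s)
(`avgBlockLZ_le_of_run`).

It remains to find good encoders with at most α^(2m) states. `blockEncoder` keeps the last m letters
and a phase modulo m, which takes m·α^m states, and once every m letters it emits the codeword of
its register. The code is a Shannon code for the empirical distribution and costs on average at most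
the entropy plus one bit per word. Phase zero gives the bound with non-overlapping blocks. For the
sliding windows, the register starts with the cyclic past of the sequence and the m phases are
averaged: together they encode each cyclic window exactly once. Nothing is lost at the boundary, so
the logarithmic term of the statement is a nonnegative surplus.

Redundancy terms exist by the converse of Ziv and Lempel, proved with generating functions.
Losslessness caps the sum of r^(length) (r/2)^(output length) over distinct phrases
(`InformationLossless.sum_weight_le`), and concavity of the logarithm turns this cap into a bound on
c log c (`lzCount_mul_log_le`). Its error term, a constant times c, is o(n) uniformly because c log
c = O(n). -/

namespace LZBlocks

universe u

/-! ### Prefix codes -/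

/-- A binary code none of whose codewords is a prefix of another one. -/
def IsPrefixCode {A : Type*} (c : A → List Bool) : Prop :=
  ∀ a b, c a <+: c b → a = b

theorem IsPrefixCode.append_inj {A : Type*} {c : A → List Bool} (hc : IsPrefixCode c) {a b : A}
    {r t : List Bool} (h : c a ++ r = c b ++ t) : a = b ∧ r = t := by
  have hab : a = b := by
    rcases List.prefix_or_prefix_of_prefix (List.prefix_append (c a) r)
      (h ▸ List.prefix_append (c b) t) with h' | h'
    · exact hc _ _ h'
    · exact (hc _ _ h').symm
  subst hab
  exact ⟨rfl, List.append_cancel_left h⟩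

/-- Among the binary strings of length `L`, one avoids a given family of prefixes whose Kraft sum
leaves room for it. -/
theorem exists_list_avoiding_prefixes {A : Type*} (s : Finset A) (c : A → List Bool) (L : ℕ)
    (hL : ∀ a ∈ s, (c a).length ≤ L) (hs : ∑ a ∈ s, (1 / 2 : ℝ) ^ (c a).length < 1) :
    ∃ t : List Bool, t.length = L ∧ ∀ a ∈ s, ¬ c a <+: t := by
  classical
  let all : Finset (List Bool) := Finset.univ.image fun v : Fin L → Bool => List.ofFn v
  let bad : A → Finset (List Bool) := fun a =>
    Finset.univ.image fun v : Fin (L - (c a).length) → Bool => c a ++ List.ofFn v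
  have hall : all.card = 2 ^ L := by
    rw [Finset.card_image_of_injective _ List.ofFn_injective]; simp
  have hbad : (s.biUnion bad).card < all.card := by
    refine lt_of_le_of_lt Finset.card_biUnion_le ?_
    rw [hall]
    have h1 : ∀ a ∈ s, ((bad a).card : ℝ) ≤ 2 ^ L * (1 / 2 : ℝ) ^ (c a).length := by
      intro a ha
      have h2 : (bad a).card ≤ 2 ^ (L - (c a).length) := by
        refine Finset.card_image_le.trans ?_
        simp
      have h3 : (2 : ℝ) ^ L = 2 ^ (L - (c a).length) * 2 ^ (c a).length := by
        rw [← pow_add, Nat.sub_add_cancel (hL a ha)]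
      rw [h3, mul_assoc, ← mul_pow]
      norm_num
      exact_mod_cast h2
    have h4 : ((∑ a ∈ s, (bad a).card : ℕ) : ℝ) < ((2 ^ L : ℕ) : ℝ) := by
      push_cast
      refine (Finset.sum_le_sum h1).trans_lt ?_
      rw [← Finset.mul_sum]
      exact mul_lt_of_lt_one_right (by positivity) hs
    exact_mod_cast h4
  obtain ⟨t, ht, ht'⟩ := Finset.exists_mem_notMem_of_card_lt_card hbad
  obtain ⟨v, -, rfl⟩ := Finset.mem_image.1 ht
  refine ⟨List.ofFn v, List.length_ofFn, ?_⟩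
  rintro a ha ⟨r, hr⟩
  refine ht' ?_
  refine Finset.mem_biUnion.2 ⟨a, ha, Finset.mem_image.2 ?_⟩
  have hlen : r.length = L - (c a).length := by
    have := congrArg List.length hr
    simp at this
    omega
  refine ⟨fun i => r.get (i.cast hlen.symm), Finset.mem_univ _, ?_⟩
  rw [← hr]
  congr 1
  refine List.ext_get (by simp [hlen]) ?_
  intro i h1 h2
  simp

/-- The converse of Kraft's inequality. -/
theorem exists_isPrefixCode_of_kraft {A : Type*} [Fintype A] (ℓ : A → ℕ)
    (h : ∑ a, (1 / 2 : ℝ) ^ ℓ a ≤ 1) :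
    ∃ c : A → List Bool, IsPrefixCode c ∧ ∀ a, (c a).length = ℓ a := by
  classical
  suffices H : ∀ s : Finset A, ∑ a ∈ s, (1 / 2 : ℝ) ^ ℓ a ≤ 1 →
      ∃ c : A → List Bool, (∀ a ∈ s, ∀ b ∈ s, c a <+: c b → a = b) ∧
        ∀ a ∈ s, (c a).length = ℓ a by
    obtain ⟨c, h1, h2⟩ := H Finset.univ h
    exact ⟨c, fun a b => h1 a (Finset.mem_univ _) b (Finset.mem_univ _),
      fun a => h2 a (Finset.mem_univ _)⟩
  intro s
  -- Letters are inserted by increasing length: the new word is at least as long as the earlier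
  -- ones, so it suffices that none of them is a prefix of it.
  induction s using Finset.induction_on_max_value ℓ with
  | empty => intro _; exact ⟨fun _ => [], by simp, by simp⟩
  | insert a s ha hmax ih =>
    intro hs
    rw [Finset.sum_insert ha] at hs
    have hpos : (0 : ℝ) < (1 / 2) ^ ℓ a := by positivity
    obtain ⟨c, hc, hl⟩ := ih (by linarith)
    obtain ⟨t, htl, ht⟩ := exists_list_avoiding_prefixes s c (ℓ a)
      (fun b hb => (hl b hb).trans_le (hmax b hb))
      (by rw [Finset.sum_congr rfl fun b hb => by rw [hl b hb]]; linarith)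
    have hne : ∀ b ∈ s, b ≠ a := fun b hb e => ha (e ▸ hb)
    refine ⟨Function.update c a t, ?_, ?_⟩
    · intro b hb d hd hp
      rcases Finset.mem_insert.1 hb with rfl | hb' <;>
        rcases Finset.mem_insert.1 hd with rfl | hd'
      · rfl
      · rw [Function.update_self, Function.update_of_ne (hne d hd')] at hp
        refine absurd ?_ (ht d hd')
        rw [hp.eq_of_length_le]
        rw [htl, hl d hd']
        exact hmax d hd'
      · rw [Function.update_self, Function.update_of_ne (hne b hb')] at hp
        exact absurd hp (ht b hb')
      · rw [Function.update_of_ne (hne b hb'), Function.update_of_ne (hne d hd')] at hp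
        exact hc b hb' d hd' hp
    · intro b hb
      rcases Finset.mem_insert.1 hb with rfl | hb
      · rw [Function.update_self, htl]
      · rw [Function.update_of_ne (hne b hb), hl b hb]

/-! ### Coding an empirical distribution -/

/-- For every probability vector `p`, there is a prefix code on the whole alphabet, with words of
length at most `1 - log₂ (p a)` for the letters of positive probability. -/
theorem exists_isPrefixCode_length_le {A : Type*} [Fintype A] (p : A → ℝ) (hp : ∀ a, 0 ≤ p a)
    (hp1 : ∑ a, p a = 1) :
    ∃ c : A → List Bool, IsPrefixCode c ∧
      ∀ a, 0 < p a → ((c a).length : ℝ) ≤ -Real.logb 2 (p a) + 1 := by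
  have hple : ∀ a, p a ≤ 1 := fun a => hp1 ▸ Finset.single_le_sum (fun b _ => hp b)
    (Finset.mem_univ a)
  -- Floor plus one strictly exceeds `-log₂ (p a)`, where a ceiling might not. The Kraft sum over
  -- the support is then strictly below 1.
  let ℓ : A → ℕ := fun a => ⌊-Real.logb 2 (p a)⌋₊ + 1
  have hlt : ∀ a, 0 < p a → (1 / 2 : ℝ) ^ ℓ a < p a := by
    intro a ha
    have h1 : -Real.logb 2 (p a) < ℓ a := by
      simp only [ℓ]; push_cast; exact Nat.lt_floor_add_one _
    calc (1 / 2 : ℝ) ^ ℓ a = (2 : ℝ) ^ (-(ℓ a : ℝ)) := by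
          rw [Real.rpow_neg zero_le_two, Real.rpow_natCast, one_div, inv_pow]
      _ < (2 : ℝ) ^ Real.logb 2 (p a) := Real.rpow_lt_rpow_of_exponent_lt one_lt_two (by linarith)
      _ = p a := Real.rpow_logb two_pos (by norm_num) ha
  let s : Finset A := Finset.univ.filter fun a => 0 < p a
  have hsum : ∑ a ∈ s, p a = 1 := by
    rw [← hp1]
    refine Finset.sum_subset (Finset.filter_subset _ _) fun a _ ha => ?_
    simp only [s, Finset.mem_filter, Finset.mem_univ, true_and, not_lt] at ha
    exact le_antisymm ha (hp a)
  have hs : s.Nonempty := by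
    rw [Finset.nonempty_iff_ne_empty]; intro h; rw [h] at hsum; simp at hsum
  have hgap : ∑ a ∈ s, (1 / 2 : ℝ) ^ ℓ a < 1 := by
    refine lt_of_lt_of_eq ?_ hsum
    exact Finset.sum_lt_sum_of_nonempty hs fun a ha => hlt a (Finset.mem_filter.1 ha).2
  -- The gap in the Kraft sum accommodates words of a large common length `N` for the letters of
  -- probability zero. They need codewords too, since an encoder must be lossless on every input.
  obtain ⟨N, hN⟩ : ∃ N : ℕ, (1 / 2 : ℝ) ^ N <
      (1 - ∑ a ∈ s, (1 / 2 : ℝ) ^ ℓ a) / (Fintype.card A + 1) :=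
    exists_pow_lt_of_lt_one (div_pos (by linarith) (by positivity)) (by norm_num)
  obtain ⟨c, hc, hcl⟩ := exists_isPrefixCode_of_kraft (fun a => if 0 < p a then ℓ a else N) (by
    rw [← Finset.sum_filter_add_sum_filter_not Finset.univ (fun a => 0 < p a)]
    have h1 : ∑ a ∈ Finset.univ.filter (fun a => 0 < p a),
        (1 / 2 : ℝ) ^ (if 0 < p a then ℓ a else N) = ∑ a ∈ s, (1 / 2 : ℝ) ^ ℓ a :=
      Finset.sum_congr rfl fun a ha => by rw [if_pos (Finset.mem_filter.1 ha).2]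
    have h2 : ∑ a ∈ Finset.univ.filter (fun a => ¬ 0 < p a),
        (1 / 2 : ℝ) ^ (if 0 < p a then ℓ a else N) ≤ Fintype.card A * (1 / 2 : ℝ) ^ N := by
      rw [Finset.sum_congr rfl fun a ha => by rw [if_neg (Finset.mem_filter.1 ha).2],
        Finset.sum_const, nsmul_eq_mul]
      gcongr
      exact Finset.card_le_univ _
    rw [lt_div_iff₀ (by positivity)] at hN
    have h3 : (0 : ℝ) < (1 / 2) ^ N := by positivity
    rw [h1]
    linarith)
  refine ⟨c, hc, fun a ha => ?_⟩
  rw [hcl, if_pos ha]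
  simp only [ℓ]
  push_cast
  have := Nat.floor_le (neg_nonneg.2 (Real.logb_nonpos one_lt_two (hp a) (hple a)))
  linarith

section Empirical

variable {ι A : Type*} [Fintype ι] [DecidableEq A]

theorem empiricalDist_nonneg (w : ι → A) (a : A) : 0 ≤ empiricalDist w a := by
  unfold empiricalDist; positivity

theorem empiricalDist_le_one (w : ι → A) (a : A) : empiricalDist w a ≤ 1 := by
  unfold empiricalDist
  refine div_le_one_of_le₀ ?_ (by positivity)
  exact_mod_cast Finset.card_le_univ _

theorem sum_comp_eq_card_mul_sum_empiricalDist [Nonempty ι] [Fintype A] (w : ι → A) (φ : A → ℝ) :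
    ∑ i, φ (w i) = Fintype.card ι * ∑ a, empiricalDist w a * φ a := by
  have hι : (Fintype.card ι : ℝ) ≠ 0 := by exact_mod_cast Fintype.card_ne_zero
  rw [← Finset.sum_fiberwise Finset.univ w, Finset.mul_sum]
  refine Finset.sum_congr rfl fun a _ => ?_
  rw [Finset.sum_congr rfl fun i hi => by rw [(Finset.mem_filter.1 hi).2], Finset.sum_const,
    nsmul_eq_mul, empiricalDist, ← mul_assoc, mul_div_cancel₀ _ hι]

theorem sum_empiricalDist [Nonempty ι] [Fintype A] (w : ι → A) : ∑ a, empiricalDist w a = 1 := by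
  have h := sum_comp_eq_card_mul_sum_empiricalDist w fun _ => 1
  have hι : (Fintype.card ι : ℝ) ≠ 0 := by exact_mod_cast Fintype.card_ne_zero
  simp only [mul_one, Finset.sum_const, Finset.card_univ, nsmul_eq_mul] at h
  exact (mul_left_cancel₀ hι (by linarith)).symm

theorem empiricalEntropy_nonneg [Fintype A] (w : ι → A) : 0 ≤ empiricalEntropy w := by
  rw [empiricalEntropy, neg_nonneg]
  exact Finset.sum_nonpos fun a _ => mul_nonpos_of_nonneg_of_nonpos (empiricalDist_nonneg w a)
    (Real.logb_nonpos one_lt_two (empiricalDist_nonneg w a) (empiricalDist_le_one w a))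

/-- A finite family has a prefix code of average length at most its empirical entropy plus one. -/
theorem exists_isPrefixCode_sum_length_le [Nonempty ι] [Fintype A] (w : ι → A) :
    ∃ c : A → List Bool, IsPrefixCode c ∧
      ∑ i, ((c (w i)).length : ℝ) ≤ Fintype.card ι * (empiricalEntropy w + 1) := by
  obtain ⟨c, hc, hl⟩ := exists_isPrefixCode_length_le (empiricalDist w) (empiricalDist_nonneg w)
    (sum_empiricalDist w)
  refine ⟨c, hc, ?_⟩
  rw [sum_comp_eq_card_mul_sum_empiricalDist w fun a => ((c a).length : ℝ)]
  refine mul_le_mul_of_nonneg_left ?_ (by positivity)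
  calc ∑ a, empiricalDist w a * ((c a).length : ℝ)
      ≤ ∑ a, empiricalDist w a * (-Real.logb 2 (empiricalDist w a) + 1) := by
        refine Finset.sum_le_sum fun a _ => ?_
        rcases (empiricalDist_nonneg w a).eq_or_lt with h | h
        · simp [← h]
        · exact mul_le_mul_of_nonneg_left (hl a h) h.le
    _ = empiricalEntropy w + 1 := by
        simp only [mul_add, mul_one, mul_neg, Finset.sum_add_distrib, Finset.sum_neg_distrib,
          sum_empiricalDist, empiricalEntropy]

end Empirical

/-! ### Runs of encoders -/

namespace FSEncoder

variable {X : Type u} {Z : Type}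

theorem output_with_init (E : FSEncoder X Z) (z₀ z : Z) (l : List X) :
    ({ E with init := z₀ } : FSEncoder X Z).output z l = E.output z l := by
  induction l generalizing z with
  | nil => rfl
  | cons a l ih => simp only [output, ih]

theorem finalState_with_init (E : FSEncoder X Z) (z₀ z : Z) (l : List X) :
    ({ E with init := z₀ } : FSEncoder X Z).finalState z l = E.finalState z l := by
  induction l generalizing z with
  | nil => rfl
  | cons a l ih => simp only [finalState, ih]

theorem InformationLossless.with_init {E : FSEncoder X Z} (hE : E.InformationLossless) (z₀ : Z) :
    ({ E with init := z₀ } : FSEncoder X Z).InformationLossless := by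
  intro z n v w hv hw
  simp only [output_with_init, finalState_with_init]
  exact hE z n v w hv hw

/-- The states form a sequence on ℕ, so that starting at a later block amounts to a shift of `S`. -/
theorem length_output_ofFn (E : FSEncoder X Z) {k : ℕ} (y : Fin k → X) (S : ℕ → Z)
    (hS : ∀ t : Fin k, E.g (S t) (y t) = S (t + 1)) :
    (E.output (S 0) (List.ofFn y)).length = ∑ t : Fin k, (E.f (S t) (y t)).length := by
  induction k generalizing S with
  | zero => simp [output]
  | succ k ih =>
    rw [List.ofFn_succ, output, List.length_append, Fin.sum_univ_succ]
    have h0 := hS 0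
    simp only [Fin.val_zero, zero_add] at h0
    rw [h0, ih (fun i => y i.succ) (fun t => S (t + 1)) fun t => by
      have := hS t.succ
      simpa using this]
    simp

end FSEncoder

/-- The starting state `z` is free because losslessness is required from every state; replacing
`init` by `z` gives a competitor in the infimum. -/
theorem compressibility_le {X : Type u} {Z : Type} [Fintype Z] (E : FSEncoder X Z)
    (hE : E.InformationLossless) {s : ℕ} (hs : Fintype.card Z ≤ s) {n : ℕ} (x : Fin n → X) (z : Z) :
    compressibility s x ≤ ((E.output z (List.ofFn x)).length : ℝ) / n := by
  refine csInf_le ⟨0, ?_⟩ ⟨Z, inferInstance, { E with init := z }, hs, hE.with_init z, ?_⟩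
  · rintro r ⟨Z, _, E, -, -, rfl⟩
    unfold FSEncoder.compressionRatio
    positivity
  · exact congrArg (fun l : List Bool => (l.length : ℝ) / n) (E.output_with_init z z _).symm

theorem sum_range_mul_eq (f : ℕ → ℝ) (q k : ℕ) :
    ∑ t ∈ Finset.range (q * k), f t =
      ∑ i ∈ Finset.range q, ∑ t ∈ Finset.range k, f (i * k + t) := by
  induction q with
  | zero => simp
  | succ q ih => rw [Nat.succ_mul, Finset.sum_range_add, ih, Finset.sum_range_succ]

theorem sum_range_add_mod (φ : ℕ → ℝ) (n a : ℕ) :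
    ∑ t ∈ Finset.range n, φ ((t + a) % n) = ∑ t ∈ Finset.range n, φ t := by
  rcases Nat.eq_zero_or_pos n with rfl | hn
  · simp
  · have : NeZero n := ⟨hn.ne'⟩
    rw [Finset.sum_range, Finset.sum_range]
    refine Eq.trans ?_ (Equiv.sum_comp (Equiv.addRight (Fin.ofNat n a)) fun t : Fin n => φ t)
    refine Finset.sum_congr rfl fun t _ => ?_
    simp [Fin.val_add]

/-- Cutting the run of a lossless encoder along the `k`-blocks bounds the average LZ complexity of
these blocks. -/
theorem avgBlockLZ_le_of_run {X : Type u} [DecidableEq X] {Z : Type} [Fintype Z]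
    {ε₂ : ℕ → ℕ → ℝ} (hε : IsRedundancyTerm X ε₂) (E : FSEncoder X Z)
    (hE : E.InformationLossless) {s : ℕ} (hs1 : 1 ≤ s) (hs : Fintype.card Z ≤ s) {k n : ℕ}
    (hk : 1 ≤ k) (hn : 1 ≤ n) (hkn : k ∣ n) (x : Fin n → X) (S : ℕ → Z)
    (hS : ∀ t : Fin n, E.g (S t) (x t) = S (t + 1)) (L : ℕ → ℝ)
    (hL : ∀ t : Fin n, ((E.f (S t) (x t)).length : ℝ) = L t) :
    avgBlockLZ x k ≤ (∑ t ∈ Finset.range n, L t) / n + ε₂ k s := by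
  have hk0 : (0 : ℝ) < k := by exact_mod_cast hk
  have hn0 : (0 : ℝ) < n := by exact_mod_cast hn
  have hlt : ∀ (i : Fin (n / k)) (t : Fin k), i * k + t < n := by
    intro i t
    have h1 : ((i : ℕ) + 1) * k ≤ n / k * k := Nat.mul_le_mul_right k i.isLt
    have h2 : n / k * k ≤ n := Nat.div_mul_le_self n k
    have h3 := t.isLt
    rw [Nat.add_mul, Nat.one_mul] at h1
    omega
  -- The encoder restarted in the state that the run has reached at the beginning of the block
  -- produces on it the same output as the run.
  have hblock : ∀ i : Fin (n / k), lzComplexity (block x k i) ≤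
      (∑ t ∈ Finset.range k, L (i * k + t)) / k + ε₂ k s := by
    intro i
    have h1 := hε.2 s hs1 k hk (block x k i)
    have h2 := compressibility_le E hE hs (block x k i) (S (i * k))
    have h3 := E.length_output_ofFn (block x k i) (fun t => S (i * k + t))
      fun t => hS ⟨i * k + t, hlt i t⟩
    simp only [add_zero] at h3
    rw [h3] at h2
    have h4 : ((∑ t : Fin k, (E.f (S (i * k + t)) (block x k i t)).length : ℕ) : ℝ) =
        ∑ t ∈ Finset.range k, L (i * k + t) := by
      rw [Finset.sum_range]
      push_cast
      exact Finset.sum_congr rfl fun t _ => hL ⟨i * k + t, hlt i t⟩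
    rw [h4] at h2
    linarith
  obtain ⟨q, rfl⟩ := hkn
  have hq : k * q / k = q := Nat.mul_div_cancel_left q hk
  have hsum : ∑ i : Fin (k * q / k), lzComplexity (block x k i) ≤
      (∑ t ∈ Finset.range (k * q), L t) / k + q * ε₂ k s := by
    refine (Finset.sum_le_sum fun i _ => hblock i).trans_eq ?_
    rw [Finset.sum_add_distrib, ← Finset.sum_div, mul_comm k q, sum_range_mul_eq,
      Finset.sum_const, Finset.card_univ, Fintype.card_fin, nsmul_eq_mul,
      ← Finset.sum_range fun i => ∑ t ∈ Finset.range k, L (i * k + t), mul_comm q k, hq]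
  have hq0 : (q : ℝ) ≠ 0 := by
    rintro h
    push_cast at hn0
    rw [h] at hn0
    simp at hn0
  calc avgBlockLZ x k
      ≤ (k : ℝ) / (k * q : ℕ) * ((∑ t ∈ Finset.range (k * q), L t) / k + q * ε₂ k s) :=
        mul_le_mul_of_nonneg_left hsum (by positivity)
    _ = _ := by
        push_cast
        field_simp

/-! ### The block encoder of a prefix code -/

section BlockEncoder

variable {A : Type*} {m : ℕ}

/-- Shift register: forget the oldest letter and append a new one. -/
def shiftIn (w : Fin m → A) (a : A) : Fin m → A := fun i =>
  if h : (i : ℕ) + 1 < m then w ⟨i + 1, h⟩ else a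

variable {X : Type u} {α : ℕ}

/-- The encoder that emits the codeword of its register once every `m` letters. Its state is made
of the number of letters read since the last emission and of the last `m` letters. -/
def blockEncoder (e : X ≃ Fin α) (c : (Fin m → X) → List Bool) (z₀ : Fin m × (Fin m → Fin α)) :
    FSEncoder X (Fin m × (Fin m → Fin α)) where
  init := z₀
  f z a := if (z.1 + 1 : ℕ) % m = 0 then c fun i => e.symm (shiftIn z.2 (e a) i) else []
  g z a := (⟨(z.1 + 1 : ℕ) % m, Nat.mod_lt _ z.1.pos⟩, shiftIn z.2 (e a))

theorem shiftIn_agree {w₁ w₂ : Fin m → A} {a b : A} {t : ℕ} (ht : t < m)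
    (h : ∀ i : Fin m, m ≤ i + (t + 1) → shiftIn w₁ a i = shiftIn w₂ b i) :
    a = b ∧ ∀ i : Fin m, m ≤ i + t → w₁ i = w₂ i := by
  constructor
  · have := h ⟨m - 1, by omega⟩ (by simp only; omega)
    have hm : ¬ (m - 1 + 1 < m) := by omega
    simpa [shiftIn, hm] using this
  · intro i hi
    have hi0 : (i : ℕ) ≠ 0 := by omega
    have := h ⟨i - 1, by omega⟩ (by simp only; omega)
    have h1 : (i : ℕ) - 1 + 1 = i := by omega
    simpa [shiftIn, h1] using this

/-- In phase `t` only the last `t` letters of the register are still to be emitted, so the two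
registers may differ and are only claimed to agree there. At an emission the prefix property
recovers the whole register; between emissions, agreement of the successor registers on `t + 1`
letters passes back through the shift. Letters never emitted are read off the final state. -/
theorem blockEncoder_agree (e : X ≃ Fin α) {c : (Fin m → X) → List Bool} (hc : IsPrefixCode c)
    (z₀ : Fin m × (Fin m → Fin α)) (v w : List X) (hvw : v.length = w.length) (t : Fin m)
    (r₁ r₂ : Fin m → Fin α)
    (ho : (blockEncoder e c z₀).output (t, r₁) v = (blockEncoder e c z₀).output (t, r₂) w)
    (hf : (blockEncoder e c z₀).finalState (t, r₁) v =
      (blockEncoder e c z₀).finalState (t, r₂) w) :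
    v = w ∧ ∀ i : Fin m, m ≤ i + t → r₁ i = r₂ i := by
  induction v generalizing w t r₁ r₂ with
  | nil =>
    obtain rfl : w = [] := List.length_eq_zero_iff.1 hvw.symm
    simp only [FSEncoder.finalState, Prod.mk.injEq, true_and] at hf
    exact ⟨rfl, fun i _ => by rw [hf]⟩
  | cons a v ih =>
    obtain _ | ⟨b, w⟩ := w
    · simp at hvw
    simp only [List.length_cons, add_left_inj] at hvw
    simp only [FSEncoder.output] at ho
    simp only [FSEncoder.finalState] at hf
    by_cases h : ((t : ℕ) + 1) % m = 0
    · simp only [blockEncoder, h, if_true] at ho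
      obtain ⟨h1, h2⟩ := hc.append_inj ho
      have h3 : ∀ i : Fin m, shiftIn r₁ (e a) i = shiftIn r₂ (e b) i := fun i =>
        e.symm.injective (congrFun h1 i)
      obtain ⟨h4, h5⟩ := shiftIn_agree t.isLt fun i _ => h3 i
      have h6 := ih w hvw _ _ _ (by simpa only [blockEncoder, h] using h2) hf
      exact ⟨by rw [e.injective h4, h6.1], h5⟩
    · have ht : (t : ℕ) + 1 < m := by
        rcases Nat.lt_or_ge ((t : ℕ) + 1) m with h' | h'
        · exact h'
        · have : (t : ℕ) + 1 = m := le_antisymm t.isLt h'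
          rw [this, Nat.mod_self] at h
          exact absurd rfl h
      have ho' : (blockEncoder e c z₀).output ((blockEncoder e c z₀).g (t, r₁) a) v =
          (blockEncoder e c z₀).output ((blockEncoder e c z₀).g (t, r₂) b) w := by
        have h1 : ∀ r y, (blockEncoder e c z₀).f (t, r) y = [] := fun r y => if_neg h
        rwa [h1, h1, List.nil_append, List.nil_append] at ho
      obtain ⟨h1, h2⟩ := ih w hvw _ _ _ ho' hf
      obtain ⟨h4, h5⟩ := shiftIn_agree t.isLt fun i hi => h2 i (by
        simpa only [Nat.mod_eq_of_lt ht] using hi)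
      exact ⟨by rw [e.injective h4, h1], h5⟩

theorem blockEncoder_informationLossless (e : X ≃ Fin α) {c : (Fin m → X) → List Bool}
    (hc : IsPrefixCode c) (z₀ : Fin m × (Fin m → Fin α)) :
    (blockEncoder e c z₀).InformationLossless := fun z _ v w hv hw ho hf =>
  (blockEncoder_agree e hc z₀ v w (hv.trans hw.symm) z.1 z.2 z.2 ho hf).1

/-- The cyclic window of length `m` of `xⁿ` that ends just before position `t`. -/
def pastWindow {n : ℕ} (hn : 1 ≤ n) (x : Fin n → X) (m t : ℕ) : Fin m → X := fun i =>
  x ⟨(t + i + m * (n - 1)) % n, Nat.mod_lt _ hn⟩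

/-- Modulo `n`, adding `m * (n - 1)` is subtracting `m`. This avoids truncated subtraction in
`pastWindow`, also when `m` exceeds `n`. -/
theorem mul_pred_add {n : ℕ} (hn : 1 ≤ n) (m : ℕ) : m + m * (n - 1) = n * m := by
  obtain ⟨q, rfl⟩ := Nat.exists_eq_add_of_le' hn
  simp only [Nat.add_sub_cancel]
  ring

theorem shiftIn_pastWindow {n : ℕ} (hn : 1 ≤ n) (x : Fin n → X) (e : X ≃ Fin α) (t : Fin n) :
    shiftIn (fun i => e (pastWindow hn x m t i)) (e (x t)) =
      fun i => e (pastWindow hn x m (t + 1) i) := by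
  funext i
  unfold shiftIn pastWindow
  split_ifs with h
  · have h1 : (t : ℕ) + (i + 1) + m * (n - 1) = t + 1 + i + m * (n - 1) := by omega
    simp only [h1]
  · congr 1
    have h1 : (t : ℕ) + 1 + i + m * (n - 1) = t + n * m := by
      rw [← mul_pred_add hn m]; omega
    congr 1
    refine Fin.ext ?_
    simp only [h1, Nat.add_mul_mod_self_left, Nat.mod_eq_of_lt t.isLt]

theorem pastWindow_succ_eq_cyclicWindow {n : ℕ} (hn : 1 ≤ n) (x : Fin n → X) (m t : ℕ) :
    pastWindow hn x m (t + 1) =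
      cyclicWindow x m ⟨(t + (1 + m * (n - 1))) % n, Nat.mod_lt _ hn⟩ := by
  funext i
  unfold pastWindow cyclicWindow
  congr 1
  refine Fin.ext ?_
  simp only [Nat.mod_add_mod]
  congr 1
  omega

theorem pastWindow_eq_block {n : ℕ} (hn : 1 ≤ n) (x : Fin n → X) (m : ℕ) (i : Fin (n / m)) :
    pastWindow hn x m (i * m + m) = block x m i := by
  funext j
  unfold pastWindow block
  congr 1
  refine Fin.ext ?_
  have h1 : ((i : ℕ) + 1) * m ≤ n / m * m := Nat.mul_le_mul_right m i.isLt
  have h2 : n / m * m ≤ n := Nat.div_mul_le_self n m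
  have h3 := j.isLt
  rw [Nat.add_mul, Nat.one_mul] at h1
  have h4 : (i : ℕ) * m + m + j + m * (n - 1) = i * m + j + n * m := by
    rw [← mul_pred_add hn m]; omega
  simp only [h4, Nat.add_mul_mod_self_left]
  exact Nat.mod_eq_of_lt (by omega)

end BlockEncoder

/-- The left side is the number of states of the block encoder. A one-letter alphabet fails here,
and is treated separately. -/
theorem mul_pow_le_pow_two_mul {α : ℕ} (hα : 2 ≤ α) (m : ℕ) : m * α ^ m ≤ α ^ (2 * m) := by
  rw [two_mul, pow_add]
  exact Nat.mul_le_mul_right _ (Nat.lt_pow_self hα).le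

/-! ### The two entropy bounds -/

section Bounds

variable {X : Type u} [Fintype X] [DecidableEq X] {ε₂ : ℕ → ℕ → ℝ}

/-- The bound given by the block encoder of a prefix code, started in phase `j`. -/
theorem avgBlockLZ_le_of_isPrefixCode (hε : IsRedundancyTerm X ε₂) (hX : 2 ≤ Fintype.card X)
    {k n m : ℕ} (hk : 1 ≤ k) (hn : 1 ≤ n) (hkn : k ∣ n) (hm : 1 ≤ m) (x : Fin n → X)
    {c : (Fin m → X) → List Bool} (hc : IsPrefixCode c) (j : ℕ) :
    avgBlockLZ x k ≤ (∑ t ∈ Finset.range n,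
        if (j + (t + 1)) % m = 0 then ((c (pastWindow hn x m (t + 1))).length : ℝ) else 0) / n +
      ε₂ k (Fintype.card X ^ (2 * m)) := by
  let e := Fintype.equivFin X
  let S : ℕ → Fin m × (Fin m → Fin (Fintype.card X)) := fun t =>
    (⟨(j + t) % m, Nat.mod_lt _ hm⟩, fun i => e (pastWindow hn x m t i))
  refine avgBlockLZ_le_of_run hε (blockEncoder e c (S 0)) (blockEncoder_informationLossless e hc _)
    (Nat.one_le_pow _ _ (by omega)) ?_ hk hn hkn x S ?_ _ ?_
  · simpa using mul_pow_le_pow_two_mul hX m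
  · intro t
    simp only [S, blockEncoder, shiftIn_pastWindow, Nat.mod_add_mod, add_assoc]
  · intro t
    simp only [S, blockEncoder, shiftIn_pastWindow, Nat.mod_add_mod, add_assoc,
      Equiv.symm_apply_apply]
    split_ifs <;> simp

/-- A single state leaves no room for a phase counter, but over one letter the length determines the
input, so an encoder that writes nothing is lossless. -/
theorem avgBlockLZ_le_of_card_eq_one (hε : IsRedundancyTerm X ε₂) (hX : Fintype.card X = 1)
    {k n : ℕ} (hk : 1 ≤ k) (hn : 1 ≤ n) (hkn : k ∣ n) (x : Fin n → X) :
    avgBlockLZ x k ≤ ε₂ k 1 := by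
  have hsub : Subsingleton X := Fintype.card_le_one_iff_subsingleton.1 hX.le
  have := avgBlockLZ_le_of_run hε (Z := Unit) ⟨(), fun _ _ => [], fun _ _ => ()⟩
    (fun _ _ v w hv hw _ _ => List.ext_get (hv.trans hw.symm) fun _ _ _ => Subsingleton.elim _ _)
    le_rfl (by simp) hk hn hkn x (fun _ => ()) (fun _ => rfl) (fun _ => 0) (by simp)
  simpa using this

/-- The bounds for the `m` phases are added. Each time `t` is an emission time in exactly one phase,
and the past windows run through all cyclic windows, so the total output is the code length of the
whole family. No divisibility of `n` by `m` is needed. -/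
theorem avgBlockLZ_le_cswEntropy (hε : IsRedundancyTerm X ε₂) (hX : 2 ≤ Fintype.card X)
    {k n m : ℕ} (hk : 1 ≤ k) (hn : 1 ≤ n) (hkn : k ∣ n) (hm : 1 ≤ m) (x : Fin n → X) :
    avgBlockLZ x k ≤ cswEntropy x m / m + 1 / m + ε₂ k (Fintype.card X ^ (2 * m)) := by
  have : Nonempty (Fin n) := ⟨⟨0, hn⟩⟩
  obtain ⟨c, hc, hlen⟩ := exists_isPrefixCode_sum_length_le (cyclicWindow x m)
  have hm0 : (0 : ℝ) < m := by exact_mod_cast hm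
  have hn0 : (0 : ℝ) < n := by exact_mod_cast hn
  have h1 := Finset.sum_le_sum fun j (_ : j ∈ Finset.range m) =>
    avgBlockLZ_le_of_isPrefixCode hε hX hk hn hkn hm x hc j
  rw [Finset.sum_add_distrib, ← Finset.sum_div, Finset.sum_comm] at h1
  have h2 : ∀ t : ℕ, ∑ j ∈ Finset.range m,
      (if (j + (t + 1)) % m = 0 then ((c (pastWindow hn x m (t + 1))).length : ℝ) else 0) =
        ((c (pastWindow hn x m (t + 1))).length : ℝ) := fun t => by
    rw [sum_range_add_mod
      (fun r => if r = 0 then ((c (pastWindow hn x m (t + 1))).length : ℝ) else 0)]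
    simp [show m ≠ 0 by omega]
  have h3 : ∑ t ∈ Finset.range n, ((c (pastWindow hn x m (t + 1))).length : ℝ) =
      ∑ i, ((c (cyclicWindow x m i)).length : ℝ) := by
    have h4 := sum_range_add_mod (fun i => if h : i < n then
      ((c (cyclicWindow x m ⟨i, h⟩)).length : ℝ) else 0) n (1 + m * (n - 1))
    rw [Finset.sum_range fun i => if h : i < n then
      ((c (cyclicWindow x m ⟨i, h⟩)).length : ℝ) else 0] at h4
    simp only [Nat.mod_lt _ hn, Fin.is_lt, dite_true, Fin.eta] at h4
    rw [← h4]
    exact Finset.sum_congr rfl fun t _ => by rw [pastWindow_succ_eq_cyclicWindow]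
  simp only [h2, h3, Finset.sum_const, Finset.card_range, nsmul_eq_mul] at h1
  rw [Fintype.card_fin] at hlen
  have h5 : (∑ i, ((c (cyclicWindow x m i)).length : ℝ)) / n ≤ cswEntropy x m + 1 := by
    rw [div_le_iff₀ hn0, mul_comm]
    exact hlen
  have h6 : (m : ℝ) * avgBlockLZ x k ≤
      m * (cswEntropy x m / m + 1 / m + ε₂ k (Fintype.card X ^ (2 * m))) := by
    have : (m : ℝ) * (cswEntropy x m / m + 1 / m + ε₂ k (Fintype.card X ^ (2 * m))) =
        cswEntropy x m + 1 + m * ε₂ k (Fintype.card X ^ (2 * m)) := by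
      field_simp
    linarith
  exact le_of_mul_le_mul_left h6 hm0

theorem avgBlockLZ_le_nobEntropy (hε : IsRedundancyTerm X ε₂) (hX : 2 ≤ Fintype.card X)
    {k n m : ℕ} (hk : 1 ≤ k) (hn : 1 ≤ n) (hkn : k ∣ n) (hm : 1 ≤ m) (hmn : m ∣ n)
    (x : Fin n → X) :
    avgBlockLZ x k ≤ nobEntropy x m / m + 1 / m + ε₂ k (Fintype.card X ^ (2 * m)) := by
  have hq : 0 < n / m := Nat.div_pos (Nat.le_of_dvd hn hmn) hm
  have : Nonempty (Fin (n / m)) := ⟨⟨0, hq⟩⟩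
  obtain ⟨c, hc, hlen⟩ := exists_isPrefixCode_sum_length_le (block x m)
  have hm0 : (0 : ℝ) < m := by exact_mod_cast hm
  have hq0 : (0 : ℝ) < (n / m : ℕ) := by exact_mod_cast hq
  have hnq : (n : ℝ) = (n / m : ℕ) * m := by exact_mod_cast (Nat.div_mul_cancel hmn).symm
  have h1 := avgBlockLZ_le_of_isPrefixCode hε hX hk hn hkn hm x hc 0
  have h2 : ∑ t ∈ Finset.range n, (if (0 + (t + 1)) % m = 0 then
      ((c (pastWindow hn x m (t + 1))).length : ℝ) else 0) =
        ∑ i, ((c (block x m i)).length : ℝ) := by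
    rw [show Finset.range n = Finset.range (n / m * m) by rw [Nat.div_mul_cancel hmn],
      sum_range_mul_eq, Finset.sum_range]
    refine Finset.sum_congr rfl fun i _ => ?_
    -- In phase 0 the only emission within a block occurs on its last letter, when the register
    -- holds exactly that block.
    rw [Finset.sum_eq_single (m - 1)]
    · have h3 : (i : ℕ) * m + (m - 1) + 1 = i * m + m := by omega
      rw [h3, pastWindow_eq_block, if_pos (by simp)]
    · intro t ht htm
      have ht' := Finset.mem_range.1 ht
      rw [if_neg]
      rw [zero_add, add_assoc, Nat.mul_add_mod_self_right, Nat.mod_eq_of_lt (by omega)]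
      omega
    · intro h
      exact absurd (Finset.mem_range.2 (by omega)) h
  rw [h2] at h1
  rw [Fintype.card_fin] at hlen
  have h5 : (∑ i, ((c (block x m i)).length : ℝ)) / n ≤ nobEntropy x m / m + 1 / m := by
    rw [← add_div, hnq, div_mul_eq_div_div]
    refine div_le_div_of_nonneg_right ?_ hm0.le
    rw [div_le_iff₀ hq0, mul_comm]
    exact hlen
  linarith

end Bounds

/-! ### Incremental parsing -/

section Parsing

variable {X : Type u} [DecidableEq X]

theorem flatten_lzParseAux (dict : List (List X)) (cur l : List X) :
    (lzParseAux dict cur l).flatten = cur ++ l := by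
  induction l generalizing dict cur with
  | nil =>
    unfold lzParseAux
    split_ifs with h <;> simp [h]
  | cons a l ih =>
    unfold lzParseAux
    split_ifs with h
    · rw [ih]; simp
    · rw [List.flatten_cons, ih]; simp

theorem length_lzParseAux_le (dict : List (List X)) (cur l : List X) :
    (lzParseAux dict cur l).length ≤ cur.length + l.length := by
  induction l generalizing dict cur with
  | nil =>
    unfold lzParseAux
    split_ifs with h
    · simp
    · simpa using Nat.succ_le_of_lt (List.length_pos_iff.2 h)
  | cons a l ih =>
    unfold lzParseAux
    split_ifs with h
    · refine (ih _ _).trans_eq ?_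
      simp; omega
    · have := ih ((cur ++ [a]) :: dict) []
      simp only [List.length_cons, List.length_nil] at this ⊢
      omega

/-- All phrases but possibly the last one are distinct. -/
theorem exists_lzParseAux_eq_append (dict : List (List X)) (cur l : List X) :
    ∃ p t, lzParseAux dict cur l = p ++ t ∧ p.Nodup ∧ (∀ w ∈ p, w ∉ dict) ∧ t.length ≤ 1 := by
  induction l generalizing dict cur with
  | nil =>
    refine ⟨[], lzParseAux dict cur [], rfl, List.nodup_nil, by simp, ?_⟩
    unfold lzParseAux
    split_ifs <;> simp
  | cons a l ih =>
    unfold lzParseAux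
    split_ifs with h
    · exact ih _ _
    · obtain ⟨p, t, h1, h2, h3, h4⟩ := ih ((cur ++ [a]) :: dict) []
      refine ⟨(cur ++ [a]) :: p, t, by rw [h1]; rfl, ?_, ?_, h4⟩
      · exact List.nodup_cons.2 ⟨fun hm => h3 _ hm (List.mem_cons_self ..), h2⟩
      · intro w hw
        rcases List.mem_cons.1 hw with rfl | hw
        · exact h
        · exact fun hd => h3 w hw (List.mem_cons_of_mem _ hd)

theorem lzCount_le {n : ℕ} (x : Fin n → X) : lzCount x ≤ n := by
  simpa [lzCount, lzParse] using length_lzParseAux_le [] [] (List.ofFn x)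

end Parsing

/-! ### Counting bounds -/

theorem sum_pow_le_inv_one_sub {r : ℝ} (h0 : 0 ≤ r) (h1 : r < 1) (N : Finset ℕ) :
    ∑ l ∈ N, r ^ l ≤ (1 - r)⁻¹ := by
  rw [← tsum_geometric_of_lt_one h0 h1]
  exact (summable_geometric_of_lt_one h0 h1).sum_le_tsum N fun _ _ => by positivity

/-- There are at most `2 ^ l` binary strings of length `l`, so the factor 1/2 leaves a geometric
series in `r`. -/
theorem sum_pow_length_le_inv_one_sub {r : ℝ} (h0 : 0 ≤ r) (h1 : r < 1)
    (S : Finset (List Bool)) : ∑ y ∈ S, (r / 2) ^ y.length ≤ (1 - r)⁻¹ := by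
  refine le_trans ?_ (sum_pow_le_inv_one_sub h0 h1 (S.image List.length))
  rw [← Finset.sum_fiberwise_of_maps_to fun y hy => Finset.mem_image_of_mem List.length hy]
  refine Finset.sum_le_sum fun l _ => ?_
  rw [Finset.sum_congr rfl fun y hy => by rw [(Finset.mem_filter.1 hy).2], Finset.sum_const,
    nsmul_eq_mul, div_pow]
  have h2 : ((S.filter fun y => y.length = l).card : ℝ) ≤ 2 ^ l := by
    have : (S.filter fun y => y.length = l).card ≤ Fintype.card Bool ^ l :=
      Finset.card_filter_length_eq_le
    rw [Fintype.card_bool] at this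
    exact_mod_cast this
  calc _ ≤ (2 : ℝ) ^ l * (r ^ l / 2 ^ l) := by gcongr
    _ = r ^ l := by field_simp

/-- Concavity of the logarithm: a family of positive numbers of bounded sum has small logarithms
on average. -/
theorem length_mul_log_length_le (M : List ℝ) (hM : ∀ a ∈ M, 0 < a) {Q : ℝ} (hQ : 0 < Q)
    (hs : M.sum ≤ Q) :
    (M.length : ℝ) * Real.log M.length ≤ M.length * Real.log Q - (M.map Real.log).sum := by
  -- This is `log u ≤ u - 1` at `u = K * a`, summed over the family; below, `K` is the reciprocal of
  -- the mean allowed by `Q`.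
  have H : ∀ K : ℝ, 0 < K → ∀ M : List ℝ, (∀ a ∈ M, 0 < a) →
      (M.map Real.log).sum + M.length * Real.log K ≤ K * M.sum - M.length := by
    intro K hK M
    induction M with
    | nil => simp
    | cons a M ih =>
      intro hM
      have h1 := ih fun b hb => hM b (List.mem_cons_of_mem _ hb)
      have ha := hM a (List.mem_cons_self ..)
      have h2 := Real.log_le_sub_one_of_pos (mul_pos hK ha)
      rw [Real.log_mul hK.ne' ha.ne'] at h2
      simp only [List.map_cons, List.sum_cons, List.length_cons]
      push_cast
      linarith
  rcases Nat.eq_zero_or_pos M.length with h | h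
  · rw [List.length_eq_zero_iff.1 h]; simp
  · have hc : (0 : ℝ) < M.length := by exact_mod_cast h
    have h1 := H (M.length / Q) (div_pos hc hQ) M hM
    rw [Real.log_div hc.ne' hQ.ne'] at h1
    have h2 : (M.length : ℝ) / Q * M.sum ≤ M.length := by
      rw [div_mul_eq_mul_div, div_le_iff₀ hQ]
      gcongr
    linarith

/-! ### The converse of Ziv and Lempel -/

namespace FSEncoder

variable {X : Type u} {Z : Type}

/-- The phrases of a parsing, together with the states in which the encoder starts on them. -/
def phraseTrace (E : FSEncoder X Z) : Z → List (List X) → List (Z × List X)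
  | _, [] => []
  | z, w :: P => (z, w) :: E.phraseTrace (E.finalState z w) P

theorem map_snd_phraseTrace (E : FSEncoder X Z) (z : Z) (P : List (List X)) :
    (E.phraseTrace z P).map Prod.snd = P := by
  induction P generalizing z with
  | nil => rfl
  | cons w P ih => simp [phraseTrace, ih]

theorem output_append (E : FSEncoder X Z) (z : Z) (v w : List X) :
    E.output z (v ++ w) = E.output z v ++ E.output (E.finalState z v) w := by
  induction v generalizing z with
  | nil => rfl
  | cons a v ih => simp [output, finalState, ih]

theorem sum_length_output_phraseTrace (E : FSEncoder X Z) (z : Z) (P : List (List X)) :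
    ((E.phraseTrace z P).map fun q => (E.output q.1 q.2).length).sum =
      (E.output z P.flatten).length := by
  induction P generalizing z with
  | nil => rfl
  | cons w P ih => simp [phraseTrace, ih, output_append]

/-- A generating-function count of the distinct segments that a lossless encoder can tell apart. -/
theorem InformationLossless.sum_weight_le [Fintype Z] {E : FSEncoder X Z}
    (hE : E.InformationLossless) {r : ℝ} (h0 : 0 ≤ r) (h1 : r < 1) (T : Finset (Z × List X)) :
    ∑ q ∈ T, r ^ q.2.length * (r / 2) ^ (E.output q.1 q.2).length ≤
      (Fintype.card Z : ℝ) ^ 2 * ((1 - r)⁻¹ * (1 - r)⁻¹) := by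
  classical
  -- Losslessness says that this map is injective. The weight depends only on the image, so the sum
  -- is at most that over a full product: pairs of states, lengths and outputs.
  let φ : Z × List X → (Z × Z) × ℕ × List Bool := fun q =>
    ((q.1, E.finalState q.1 q.2), q.2.length, E.output q.1 q.2)
  have hφ : Function.Injective φ := by
    rintro ⟨z, v⟩ ⟨z', w⟩ h
    simp only [φ, Prod.mk.injEq] at h
    obtain ⟨⟨rfl, h2⟩, h3, h4⟩ := h
    rw [hE z _ v w h3 rfl h4 h2]
  let ψ : (Z × Z) × ℕ × List Bool → ℝ := fun b => r ^ b.2.1 * (r / 2) ^ b.2.2.length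
  let N := T.image fun q => q.2.length
  let S := T.image fun q => E.output q.1 q.2
  calc ∑ q ∈ T, r ^ q.2.length * (r / 2) ^ (E.output q.1 q.2).length
      = ∑ b ∈ T.image φ, ψ b := (Finset.sum_image (f := ψ) fun _ _ _ _ h => hφ h).symm
    _ ≤ ∑ b ∈ (Finset.univ : Finset (Z × Z)) ×ˢ (N ×ˢ S), ψ b := by
        refine Finset.sum_le_sum_of_subset_of_nonneg ?_ fun b _ _ => by positivity
        intro b hb
        obtain ⟨q, hq, rfl⟩ := Finset.mem_image.1 hb
        exact Finset.mem_product.2 ⟨Finset.mem_univ _, Finset.mem_product.2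
          ⟨Finset.mem_image_of_mem (fun q => q.2.length) hq,
            Finset.mem_image_of_mem (fun q => E.output q.1 q.2) hq⟩⟩
    _ = (Fintype.card Z : ℝ) ^ 2 *
          ((∑ l ∈ N, r ^ l) * ∑ y ∈ S, (r / 2) ^ y.length) := by
        rw [Finset.sum_product]
        simp only [ψ]
        rw [Finset.sum_const, Finset.card_univ, Fintype.card_prod,
          Finset.sum_mul_sum, ← Finset.sum_product', nsmul_eq_mul]
        push_cast
        rw [sq]
    _ ≤ _ := by
        have h2 := sum_pow_le_inv_one_sub h0 h1 N
        have h3 := sum_pow_length_le_inv_one_sub h0 h1 S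
        have h4 : 0 ≤ (1 - r)⁻¹ := inv_nonneg.2 (by linarith)
        have h5 : 0 ≤ ∑ y ∈ S, (r / 2) ^ y.length := Finset.sum_nonneg fun _ _ => by positivity
        gcongr

end FSEncoder

/-! ### From the weight count to redundancy terms -/

section Converse

variable {X : Type u} [DecidableEq X]

/-- The constant of the converse bound for `s` states at slack `δ`. -/
noncomputable def stateConst (δ : ℝ) (s : ℕ) : ℝ :=
  Real.logb 2 ((s : ℝ) ^ 2 * ((1 - 2 ^ (-δ))⁻¹ * (1 - 2 ^ (-δ))⁻¹) + 1)

theorem stateConst_nonneg (δ : ℝ) (s : ℕ) : 0 ≤ stateConst δ s := by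
  refine Real.logb_nonneg one_lt_two ?_
  have : 0 ≤ (s : ℝ) ^ 2 * ((1 - (2 : ℝ) ^ (-δ))⁻¹ * (1 - 2 ^ (-δ))⁻¹) :=
    mul_nonneg (sq_nonneg _) (mul_self_nonneg _)
  linarith

/-- With `r = 2 ^ (-δ)`, a phrase has minus log-weight `δ` times its length plus `1 + δ` times its
output length. These add up to `δ * n` and `1 + δ` times the total output, while concavity bounds `c
log c` by `c log Q` plus their sum. -/
theorem lzCount_mul_log_le {Z : Type} [Fintype Z] {E : FSEncoder X Z}
    (hE : E.InformationLossless) {s : ℕ} (hs : Fintype.card Z ≤ s) {δ : ℝ} (hδ : 0 < δ) {n : ℕ}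
    (x : Fin n → X) (z : Z) :
    (lzCount x : ℝ) * Real.logb 2 (lzCount x) ≤ lzCount x * stateConst δ s + δ * n +
      (1 + δ) * (E.output z (List.ofFn x)).length := by
  set r : ℝ := 2 ^ (-δ) with hr
  have hr0 : 0 < r := Real.rpow_pos_of_pos two_pos _
  have hr1 : r < 1 := Real.rpow_lt_one_of_one_lt_of_neg one_lt_two (by linarith)
  -- The summand 1 pays for the last phrase, which may repeat an earlier one and has weight at most
  -- 1.
  set Q : ℝ := (s : ℝ) ^ 2 * ((1 - r)⁻¹ * (1 - r)⁻¹) + 1 with hQ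
  have hQ0 : 0 < Q := by
    have : 0 ≤ (s : ℝ) ^ 2 * ((1 - r)⁻¹ * (1 - r)⁻¹) :=
      mul_nonneg (sq_nonneg _) (mul_self_nonneg _)
    linarith
  let wt : Z × List X → ℝ := fun q => r ^ q.2.length * (r / 2) ^ (E.output q.1 q.2).length
  have hwt : ∀ q, 0 < wt q := fun q => by positivity
  have hwt1 : ∀ q, wt q ≤ 1 := fun q =>
    mul_le_one₀ (pow_le_one₀ hr0.le hr1.le) (by positivity)
      (pow_le_one₀ (by positivity) (by linarith))
  have hlog : ∀ q, Real.log (wt q) = -Real.log 2 *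
      (δ * q.2.length + (1 + δ) * (E.output q.1 q.2).length) := by
    intro q
    have h1 : Real.log r = -δ * Real.log 2 := Real.log_rpow two_pos _
    simp only [wt]
    rw [Real.log_mul (by positivity) (by positivity), Real.log_pow, Real.log_pow,
      Real.log_div hr0.ne' two_ne_zero, h1]
    ring
  set P := lzParse (List.ofFn x) with hP
  set T := E.phraseTrace z P with hT
  have hTP : T.map Prod.snd = P := E.map_snd_phraseTrace z P
  have hflat : P.flatten = List.ofFn x := flatten_lzParseAux [] [] _
  have hTlen : T.length = lzCount x := by
    rw [lzCount, ← hP, ← hTP, List.length_map]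
  obtain ⟨p, t, hpt, hp, -, ht⟩ := exists_lzParseAux_eq_append [] [] (List.ofFn x)
  have hpt' : T.map Prod.snd = p ++ t := hTP.trans hpt
  obtain ⟨T₁, T₂, hT12, h1, h2⟩ := List.map_eq_append_iff.1 hpt'
  have hsum : (T.map wt).sum ≤ Q := by
    classical
    rw [hT12, List.map_append, List.sum_append]
    have hnd : T₁.Nodup := List.Nodup.of_map Prod.snd (h1 ▸ hp)
    have h3 : (T₁.map wt).sum ≤ (s : ℝ) ^ 2 * ((1 - r)⁻¹ * (1 - r)⁻¹) := by
      rw [← List.sum_toFinset wt hnd]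
      refine (hE.sum_weight_le hr0.le hr1 _).trans ?_
      have : 0 ≤ (1 - r)⁻¹ * (1 - r)⁻¹ := mul_self_nonneg _
      gcongr
    have h4 : (T₂.map wt).sum ≤ 1 := by
      rw [← h2, List.length_map] at ht
      rcases T₂ with _ | ⟨q, _ | ⟨q', T₂⟩⟩
      · simp
      · simpa using hwt1 q
      · simp at ht
    linarith
  have hmain := length_mul_log_length_le (T.map wt) (by
    intro a ha
    obtain ⟨q, -, rfl⟩ := List.mem_map.1 ha
    exact hwt q) hQ0 hsum
  have hlogsum : ∀ T' : List (Z × List X), ((T'.map wt).map Real.log).sum = -Real.log 2 *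
      (δ * ((T'.map Prod.snd).map List.length).sum +
        (1 + δ) * (T'.map fun q => (E.output q.1 q.2).length).sum) := by
    intro T'
    induction T' with
    | nil => simp
    | cons q T' ih =>
      simp only [List.map_cons, List.sum_cons, ih, hlog]
      push_cast
      ring
  have hlen : (P.map List.length).sum = n := by
    rw [← List.length_flatten, hflat, List.length_ofFn]
  rw [hlogsum, hTP, hlen, E.sum_length_output_phraseTrace, hflat, List.length_map, hTlen] at hmain
  have hl2 : 0 < Real.log 2 := Real.log_pos one_lt_two
  rw [stateConst, ← hr, ← hQ, Real.logb, Real.logb, ← mul_div_assoc, ← mul_div_assoc,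
    div_le_iff₀ hl2, add_mul, add_mul, div_mul_cancel₀ _ hl2.ne']
  linarith

variable [Fintype X]

/-- The one-state encoder that writes every letter in unary, on a fixed number of bits. -/
noncomputable def letterEncoder (X : Type u) [Fintype X] [DecidableEq X] : FSEncoder X Unit where
  init := ()
  f _ a := List.ofFn fun i => decide (i = Fintype.equivFin X a)
  g _ _ := ()

theorem letterEncoder_informationLossless : (letterEncoder X).InformationLossless := by
  intro z n v
  induction v generalizing n with
  | nil =>
    intro w hv hw _ _
    rw [← hv] at hw
    exact (List.length_eq_zero_iff.1 hw).symm
  | cons a v ih =>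
    intro w hv hw ho hf
    obtain _ | ⟨b, w⟩ := w
    · rw [← hw] at hv; simp at hv
    simp only [FSEncoder.output] at ho
    obtain ⟨h1, h2⟩ := List.append_inj ho (by simp [letterEncoder])
    have h3 : a = b := by
      have := congrFun (List.ofFn_injective h1) (Fintype.equivFin X a)
      simpa using this
    simp only [List.length_cons] at hv hw
    rw [h3, ih (n - 1) w (by omega) (by omega) h2 rfl]

theorem length_output_letterEncoder (l : List X) :
    ((letterEncoder X).output () l).length = l.length * Fintype.card X := by
  induction l with
  | nil => simp [FSEncoder.output]
  | cons a l ih =>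
    have : (letterEncoder X).g () a = () := rfl
    rw [FSEncoder.output, List.length_append, this, ih, List.length_cons]
    simp only [letterEncoder, List.length_ofFn]
    ring

/-- Uniformly in `xⁿ`, the LZ complexity is at most a constant. -/
theorem exists_lzCount_mul_log_le (X : Type u) [Fintype X] [DecidableEq X] :
    ∃ A : ℝ, 0 < A ∧ ∀ (n : ℕ) (x : Fin n → X),
      (lzCount x : ℝ) * Real.logb 2 (lzCount x) ≤ A * n := by
  -- The converse bound with `s = 1` and `δ = 1`, applied to the letter encoder, whose output has
  -- `n` times the alphabet size bits; `c ≤ n` absorbs the first term.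
  refine ⟨stateConst 1 1 + 1 + 2 * Fintype.card X, ?_, fun n x => ?_⟩
  · have := stateConst_nonneg 1 1
    positivity
  · have h1 := lzCount_mul_log_le (s := 1) letterEncoder_informationLossless (by simp) one_pos x ()
    rw [length_output_letterEncoder, List.length_ofFn] at h1
    have h2 : (lzCount x : ℝ) ≤ n := by exact_mod_cast lzCount_le x
    have h3 := mul_le_mul_of_nonneg_right h2 (stateConst_nonneg 1 1)
    push_cast at h1
    linarith

/-- Ziv and Lempel: finite-state lossless encoders do not beat the LZ complexity, up to a
redundancy that vanishes uniformly. -/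
theorem exists_forall_lzComplexity_le (X : Type u) [Fintype X] [DecidableEq X] (s : ℕ) {η : ℝ}
    (hη : 0 < η) :
    ∃ N : ℕ, ∀ n : ℕ, N ≤ n → 1 ≤ n → ∀ (x : Fin n → X) (Z : Type) [Fintype Z]
      (E : FSEncoder X Z), Fintype.card Z ≤ s → E.InformationLossless →
        lzComplexity x ≤ E.compressionRatio x + η := by
  obtain ⟨A, hA, hAle⟩ := exists_lzCount_mul_log_le X
  -- In the only nontrivial case the compression ratio is below `lzComplexity x ≤ A`, so the slack
  -- `δ * (1 + ratio)` is at most `η / 2`.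
  set δ : ℝ := η / (2 * (A + 1)) with hδ
  have hδ0 : 0 < δ := by positivity
  set K := stateConst δ s
  have hK : 0 ≤ K := stateConst_nonneg δ s
  -- Threshold for `log₂ c`: above it, `c * B ≤ A * n` gives `c * K ≤ η / 2 * n`; below it, `c` is
  -- bounded and a large `n` suffices.
  set B : ℝ := 2 * K * A / η with hB
  obtain ⟨N, hN⟩ := exists_nat_ge (K * 2 ^ B / (η / 2))
  refine ⟨N, fun n hNn hn x Z _ E hs hE => ?_⟩
  have hn0 : (0 : ℝ) < n := by exact_mod_cast hn
  have hcK : (lzCount x : ℝ) * K ≤ η / 2 * n := by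
    rcases le_or_gt (lzCount x : ℝ) (2 ^ B) with h | h
    · have h1 : K * 2 ^ B / (η / 2) ≤ n := hN.trans (by exact_mod_cast hNn)
      rw [div_le_iff₀ (by positivity)] at h1
      have h2 := mul_le_mul_of_nonneg_right h hK
      linarith
    · have hc0 : (0 : ℝ) < lzCount x := lt_trans (by positivity) h
      have h1 : B ≤ Real.logb 2 (lzCount x) := by
        rw [Real.le_logb_iff_rpow_le one_lt_two hc0]
        exact h.le
      have h2 := (mul_le_mul_of_nonneg_left h1 hc0.le).trans (hAle n x)
      have h3 : (lzCount x : ℝ) * B = A * (lzCount x * K * (2 / η)) := by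
        rw [hB]; ring
      rw [h3] at h2
      have h4 := le_of_mul_le_mul_left h2 hA
      have h5 := mul_le_mul_of_nonneg_left h4 (by positivity : 0 ≤ η / 2)
      have h6 : η / 2 * (lzCount x * K * (2 / η)) = lzCount x * K := by field_simp
      linarith
  have hmain := lzCount_mul_log_le hE hs hδ0 x E.init
  have hρ : (lzComplexity x) * n = lzCount x * Real.logb 2 (lzCount x) :=
    div_mul_cancel₀ _ hn0.ne'
  have hE' : E.compressionRatio x * n = (E.output E.init (List.ofFn x)).length :=
    div_mul_cancel₀ _ hn0.ne'
  rcases le_or_gt (lzComplexity x) (E.compressionRatio x) with h | h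
  · linarith
  · have h1 : lzComplexity x ≤ A := le_of_mul_le_mul_right (hρ.trans_le (hAle n x)) hn0
    have h2 : δ * (A + 1) = η / 2 := by rw [hδ]; field_simp
    have h3 : lzComplexity x * n ≤
        (η / 2 + δ + (1 + δ) * E.compressionRatio x) * n := by
      rw [hρ]
      calc _ ≤ _ := hmain
        _ ≤ _ := by rw [← hE']; linarith
    have h4 := le_of_mul_le_mul_right h3 hn0
    have h5 : δ * E.compressionRatio x ≤ δ * A := by
      gcongr
      linarith
    linarith

theorem exists_isRedundancyTerm (X : Type u) [Fintype X] [DecidableEq X] :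
    ∃ ε₂ : ℕ → ℕ → ℝ, IsRedundancyTerm X ε₂ := by
  have key : ∀ s : ℕ, 1 ≤ s → ∀ η : ℝ, 0 < η → ∃ N : ℕ, ∀ n : ℕ, N ≤ n → 1 ≤ n →
      ∀ x : Fin n → X, lzComplexity x - compressibility s x ≤ η := by
    intro s hs η hη
    obtain ⟨N, hN⟩ := exists_forall_lzComplexity_le X s hη
    refine ⟨N, fun n hNn hn x => ?_⟩
    rw [sub_le_comm]
    refine le_csInf ⟨_, Unit, inferInstance, letterEncoder X, by simpa using hs,
      letterEncoder_informationLossless, rfl⟩ ?_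
    rintro _ ⟨Z, _, E, hZ, hE, rfl⟩
    have := hN n hNn hn x Z E hZ hE
    linarith
  -- The worst excess over the finitely many strings of length `n`. Positive parts keep it
  -- nonnegative, so upper bounds alone give the limit 0.
  refine ⟨fun n s => ⨆ x : Fin n → X, max 0 (lzComplexity x - compressibility s x), ?_, ?_⟩
  · intro s hs
    rw [Metric.tendsto_atTop]
    intro η hη
    obtain ⟨N, hN⟩ := key s hs (η / 2) (by linarith)
    refine ⟨max N 1, fun n hn => ?_⟩
    have h0 : 0 ≤ ⨆ x : Fin n → X, max 0 (lzComplexity x - compressibility s x) :=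
      Real.iSup_nonneg fun _ => le_max_left _ _
    have h1 : ⨆ x : Fin n → X, max 0 (lzComplexity x - compressibility s x) ≤ η / 2 :=
      Real.iSup_le (fun x => max_le (by linarith)
        (hN n (le_of_max_le_left hn) (le_of_max_le_right hn) x)) (by linarith)
    rw [Real.dist_eq, sub_zero, abs_of_nonneg h0]
    linarith
  · intro s _ n _ x
    have h := le_ciSup (Set.finite_range fun x : Fin n → X =>
      max 0 (lzComplexity x - compressibility s x)).bddAbove x
    have h1 := (le_max_right 0 (lzComplexity x - compressibility s x)).trans h
    linarith

end Converse

end LZBlocks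

/-! ### Assembly of the theorem -/

theorem theorem2 {X : Type*} [Fintype X] [DecidableEq X] :
    (∃ ε₂ : ℕ → ℕ → ℝ, LZBlocks.IsRedundancyTerm X ε₂) ∧
    ∀ ε₂ : ℕ → ℕ → ℝ, LZBlocks.IsRedundancyTerm X ε₂ →
      ∀ k n m : ℕ, 1 ≤ k → 1 ≤ n → k ∣ n → 1 ≤ m → ∀ x : Fin n → X,
        (m ≤ n →
          LZBlocks.avgBlockLZ x k ≤
            LZBlocks.cswEntropy x m / m + 1 / m
              + 2 * ((m : ℝ) + 1) * (Fintype.card X : ℝ) ^ (m + 1) / n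
                * Real.logb 2 ((n : ℝ) / m)
              + ε₂ k (Fintype.card X ^ (2 * m))) ∧
        (m ∣ n →
          LZBlocks.avgBlockLZ x k ≤
            LZBlocks.nobEntropy x m / m + 1 / m
              + ε₂ k (Fintype.card X ^ (2 * m))) := by
  refine ⟨LZBlocks.exists_isRedundancyTerm X, fun ε₂ hε k n m hk hn hkn hm x => ?_⟩
  have hm0 : (0 : ℝ) < m := by exact_mod_cast hm
  have hpos : 0 < Fintype.card X := Fintype.card_pos_iff.2 ⟨x ⟨0, hn⟩⟩
  have hcsw : 0 ≤ LZBlocks.cswEntropy x m := LZBlocks.empiricalEntropy_nonneg _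
  have hnob : 0 ≤ LZBlocks.nobEntropy x m := LZBlocks.empiricalEntropy_nonneg _
  have hone : Fintype.card X = 1 →
      LZBlocks.avgBlockLZ x k ≤ ε₂ k (Fintype.card X ^ (2 * m)) := fun h => by
    rw [h, one_pow]
    exact LZBlocks.avgBlockLZ_le_of_card_eq_one hε h hk hn hkn x
  have hcases : Fintype.card X = 1 ∨ 2 ≤ Fintype.card X := by omega
  constructor
  · intro hmn
    -- The only use of `m ≤ n`: the bound already holds without this term, which must merely not be
    -- negative.
    have hlog : 0 ≤ 2 * ((m : ℝ) + 1) * (Fintype.card X : ℝ) ^ (m + 1) / n *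
        Real.logb 2 ((n : ℝ) / m) := by
      refine mul_nonneg (by positivity) (Real.logb_nonneg one_lt_two ?_)
      rw [le_div_iff₀ hm0, one_mul]
      exact_mod_cast hmn
    rcases hcases with h | h
    · have h1 : 0 ≤ LZBlocks.cswEntropy x m / m + 1 / m := by positivity
      linarith [hone h]
    · linarith [LZBlocks.avgBlockLZ_le_cswEntropy hε h hk hn hkn hm x]
  · intro hmn
    rcases hcases with h | h
    · have h1 : 0 ≤ LZBlocks.nobEntropy x m / m + 1 / m := by positivity
      linarith [hone h]
    · exact LZBlocks.avgBlockLZ_le_nobEntropy hε h hk hn hkn hm hmn x
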